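/- Let $d,n$ be positive integers, let $\mathcal D_d$ be the set of Hermitian positive semi-definite matrices in $\mathbb C^{d\times d}$ with unit trace, and let $\mathcal B_{d,++}$ be the set of Hermitian positive definite matrices in $\mathbb C^{d\times d}$. Let $A_1,\dots,A_n\in\mathcal D_d$ be such that $\sum_{j=1}^n A_j$ has full rank, let $w_1,\dots,w_n>0$ satisfy $\sum_{j=1}^n w_j=1$, and let $\alpha\in(0,1)\cup(1,\infty)$. For $A,Q\in\mathcal D_d$ let $$D_\alpha(A\Vert Q)=\frac{1}{\alpha-1}\log \operatorname{Tr}\!\left[A^\alpha Q^{1-\alpha}\right]$$ whenever $\operatorname{Tr}[A^\alpha Q^{1-\alpha}]>0$ and, if $\alpha>1$, the support of $A$ is contained in the support of $Q$ (negative powers being taken on the support), and let $D_\alpha(A\Vert Q)=+\infty$ otherwise. Then the Petz–Augustin minimization problem $$\min_{Q\in\mathcal D_d} F(Q),\qquad F(Q)=\sum_{j=1}^n w_j\,D_\alpha(A_j\Vert Q),$$ has a unique minimizer $Q_\star$, and $Q_\star$ is positive definite. Moreover, the operator $$T_F(U)=\left(\sum_{j=1}^n w_j\,\frac{A_j^\alpha}{\operatorname{Tr}[A_j^\alpha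 U]}\right)^{(1-\alpha)/\alpha}$$ maps $\mathcal B_{d,++}$ into itself, and $Q_\star^{1-\alpha}\in\mathcal B_{d,++}$ is its unique fixed point in $\mathcal B_{d,++}$. -/

import Mathlib

open scoped MatrixOrder ComplexOrder

namespace PetzAugustin

/-- The quantum states in `ℂ^{d×d}`: Hermitian positive semi-definite matrices of unit trace. -/
def states (d : ℕ) : Set (Matrix (Fin d) (Fin d) ℂ) :=
  {Q | Q.PosSemidef ∧ Q.trace = 1}

/-- The positive cone: Hermitian positive definite matrices in `ℂ^{d×d}`. -/
def posCone (d : ℕ) : Set (Matrix (Fin d) (Fin d) ℂ) :=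
  {U | U.PosDef}

/-- The quantity `Tr[A^α Q^{1-α}]`, with matrix powers given by the functional calculus. It is a
real number for positive semi-definite `A`, `Q`, so taking the real part loses nothing. For
`α > 1` and singular `Q`, the power `Q^{1-α}` is the one taken on the support of `Q`. -/
noncomputable def petzTrace {d : ℕ} (α : ℝ) (A Q : Matrix (Fin d) (Fin d) ℂ) : ℝ :=
  (A ^ α * Q ^ (1 - α)).trace.re

open Classical in
/-- The Petz-Rényi divergence `(α - 1)⁻¹ log Tr[A^α Q^{1-α}]` of order `α`, with value `+∞` where
this is not well-defined: for `α > 1` if the support of `A` is not contained in that of `Q`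
(in terms of kernels: `ker Q ⊄ ker A`), and in any case if the trace is not positive. -/
noncomputable def petzRenyiDiv {d : ℕ} (α : ℝ) (A Q : Matrix (Fin d) (Fin d) ℂ) : EReal :=
  if (1 < α → ∀ v : Fin d → ℂ, Q.mulVec v = 0 → A.mulVec v = 0) ∧ 0 < petzTrace α A Q then
    ((1 / (α - 1) * Real.log (petzTrace α A Q) : ℝ) : EReal)
  else ⊤

/-- The objective function `F(Q) = ∑ⱼ wⱼ D_α(Aⱼ ‖ Q)`. -/
noncomputable def objective {d n : ℕ} (α : ℝ) (w : Fin n → ℝ)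
    (A : Fin n → Matrix (Fin d) (Fin d) ℂ) (Q : Matrix (Fin d) (Fin d) ℂ) : EReal :=
  ∑ j, (w j : EReal) * petzRenyiDiv α (A j) Q

/-- `Q` is a minimizer of the objective function over the set of quantum states. -/
def IsMinimizer {d n : ℕ} (α : ℝ) (w : Fin n → ℝ)
    (A : Fin n → Matrix (Fin d) (Fin d) ℂ) (Q : Matrix (Fin d) (Fin d) ℂ) : Prop :=
  Q ∈ states d ∧ IsMinOn (objective α w A) (states d) Q

/-- The operator `U ↦ (∑ⱼ wⱼ Aⱼ^α / Tr[Aⱼ^α U])^{(1-α)/α}`, to be used on the positive cone. -/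
noncomputable def fixOp {d n : ℕ} (α : ℝ) (w : Fin n → ℝ)
    (A : Fin n → Matrix (Fin d) (Fin d) ℂ) (U : Matrix (Fin d) (Fin d) ℂ) :
    Matrix (Fin d) (Fin d) ℂ :=
  (∑ j, (w j / ((A j) ^ α * U).trace.re) • (A j) ^ α) ^ ((1 - α) / α)

end PetzAugustin

/-! Put B_j = A_j^α, p = 1/(1-α), U = Q^(1-α) and S(U) = ∑ w_j B_j / Tr[B_j U]. Evaluating F at the
normalization of X^p gives the scale-invariant function log Tr X^p - p ∑ w_j log Tr[B_j X]
(`realObjective_normalized`). Moving the matrix U of a minimizer in positive semi-definite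
directions shows p(U^(p-1) - S(U)) ≥ 0. This matrix has zero trace against U, since Tr U^p = 1 =
Tr[S(U) U], so it vanishes once U is positive definite (`posDef_and_average_eq_of_isMin`). As p - 1
= α/(1-α), the equation U^(p-1) = S(U) says that U is a fixed point. Definiteness comes from U^(p-1)
≥ S(U) > 0 if α < 1, and from the support condition and the full rank if α > 1.

Minimizers exist by compactness: of the set of states if α < 1, and of a set of uniformly definite
states containing a sublevel set if α > 1. Since every minimizer yields a fixed point, uniqueness of
both follows from uniqueness of fixed points. If α > 1, the exponent (1-α)/α lies in (-1, 0), and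
the Löwner–Heinz inequality makes T_F a contraction for Thompson's metric (`eq_of_average_rpow_eq`).
If α < 1, two fixed points are compared through log x ≤ x - 1 and a trace form of Young's
inequality, and the equality case of the latter identifies them (`eq_of_average_rpow_eq'`). -/

/-! ### Functional calculus, order and compactness for complex matrices -/

namespace Matrix

set_option linter.unusedSectionVars false

variable {m : Type*} [Fintype m] [DecidableEq m]

/-- The trace of a product of two functions of Hermitian matrices is a sum over pairs of
eigenvalues, with nonnegative weights which depend only on the two matrices. -/
lemma exists_trace_cfc_mul_cfc {A B : Matrix m m ℂ} (hA : A.IsHermitian) (hB : B.IsHermitian) :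
    ∃ W : m → m → ℝ, (∀ i k, 0 ≤ W i k) ∧ ∀ f g : ℝ → ℝ,
      (cfc f A * cfc g B).trace.re =
        ∑ i, ∑ k, f (hA.eigenvalues i) * g (hB.eigenvalues k) * W i k := by
  set U : Matrix m m ℂ := ↑hA.eigenvectorUnitary with hU
  set V : Matrix m m ℂ := ↑hB.eigenvectorUnitary with hV
  -- The weights are the squared overlaps of the two eigenvector bases.
  refine ⟨fun i k => Complex.normSq ((star U * V) i k), fun i k => Complex.normSq_nonneg _, ?_⟩
  intro f g
  rw [hA.cfc_eq, hB.cfc_eq, IsHermitian.cfc, IsHermitian.cfc, Unitary.conjStarAlgAut_apply,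
    Unitary.conjStarAlgAut_apply, ← hU, ← hV]
  have h : (U * diagonal (RCLike.ofReal ∘ f ∘ hA.eigenvalues) * star U *
      (V * diagonal (RCLike.ofReal ∘ g ∘ hB.eigenvalues) * star V)).trace =
      (diagonal (RCLike.ofReal ∘ f ∘ hA.eigenvalues) * (star U * V) *
        (diagonal (RCLike.ofReal ∘ g ∘ hB.eigenvalues) * star (star U * V))).trace := by
    rw [star_mul, star_star, mul_assoc U, mul_assoc U, Matrix.trace_mul_comm U]
    simp only [mul_assoc]
  rw [h]
  simp only [Matrix.trace, diag_apply, mul_apply (N := _ * star _), Complex.re_sum]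
  refine Finset.sum_congr rfl fun i _ => Finset.sum_congr rfl fun k _ => ?_
  rw [diagonal_mul, diagonal_mul, star_apply]
  generalize (star U * V) i k = z
  simp only [Function.comp_apply, Complex.normSq_apply]
  simp
  ring

lemma rpow_posSemidef (A : Matrix m m ℂ) (r : ℝ) : (A ^ r).PosSemidef :=
  nonneg_iff_posSemidef.mp CFC.rpow_nonneg

lemma PosDef.rpow {A : Matrix m m ℂ} (hA : A.PosDef) (r : ℝ) : (A ^ r).PosDef := by
  rw [(rpow_posSemidef A r).posDef_iff_isUnit]
  exact (IsStrictlyPositive.rpow A r hA.isStrictlyPositive).isUnit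

lemma PosSemidef.rpow_eq_cfc {A : Matrix m m ℂ} (hA : A.PosSemidef) (r : ℝ) :
    A ^ r = cfc (fun x : ℝ => x ^ r) A :=
  CFC.rpow_eq_cfc_real hA.nonneg

lemma continuousOn_spectrum (f : ℝ → ℝ) (A : Matrix m m ℂ) : ContinuousOn f (spectrum ℝ A) :=
  (Matrix.finite_real_spectrum (A := A)).continuousOn f

lemma PosSemidef.spectrum_nonneg {A : Matrix m m ℂ} (hA : A.PosSemidef) {x : ℝ}
    (hx : x ∈ spectrum ℝ A) : 0 ≤ x := by
  exact spectrum_nonneg_of_nonneg hA.nonneg hx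

lemma PosDef.spectrum_pos {A : Matrix m m ℂ} (hA : A.PosDef) {x : ℝ}
    (hx : x ∈ spectrum ℝ A) : 0 < x := by
  rw [hA.1.spectrum_real_eq_range_eigenvalues] at hx
  obtain ⟨i, rfl⟩ := hx
  exact hA.eigenvalues_pos i

/-- Singular matrices and negative exponents are covered: with 0^r = 0 for r ≠ 0 and 0^0 = 1, the
scalar identity also holds at the eigenvalue 0. This is what recovers Q from Q^(1-α). -/
lemma PosSemidef.rpow_rpow {A : Matrix m m ℂ} (hA : A.PosSemidef) (r s : ℝ) :
    (A ^ r) ^ s = A ^ (r * s) := by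
  rw [(rpow_posSemidef A r).rpow_eq_cfc, hA.rpow_eq_cfc, hA.rpow_eq_cfc,
    ← cfc_comp' (fun x : ℝ => x ^ s) (fun x : ℝ => x ^ r) A
      (((Matrix.finite_real_spectrum (A := A)).image _).continuousOn _)
      (continuousOn_spectrum _ _)]
  exact cfc_congr fun x hx => (Real.rpow_mul (hA.spectrum_nonneg hx) r s).symm

/-- The condition on r + s concerns the eigenvalue 0, where 0^0 = 1 but 0^r * 0^(-r) = 0 for r ≠ 0.
-/
lemma PosSemidef.rpow_mul_rpow {A : Matrix m m ℂ} (hA : A.PosSemidef) {r s : ℝ}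
    (h : r + s ≠ 0) : A ^ r * A ^ s = A ^ (r + s) := by
  rw [hA.rpow_eq_cfc, hA.rpow_eq_cfc, hA.rpow_eq_cfc,
    ← cfc_mul _ _ A (continuousOn_spectrum _ _) (continuousOn_spectrum _ _)]
  exact cfc_congr fun x hx => (Real.rpow_add' (hA.spectrum_nonneg hx) h).symm

lemma PosSemidef.smul_rpow {A : Matrix m m ℂ} (hA : A.PosSemidef) {c : ℝ} (hc : 0 ≤ c) (r : ℝ) :
    (c • A) ^ r = (c ^ r) • A ^ r := by
  have hcA : (c • A).PosSemidef := by
    exact nonneg_iff_posSemidef.mp (smul_nonneg hc hA.nonneg)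
  have h1 : cfc (fun x : ℝ => x ^ r) (c • A) = cfc (fun x : ℝ => (c * x) ^ r) A :=
    (cfc_comp_const_mul c (fun x : ℝ => x ^ r) A
      (((Matrix.finite_real_spectrum (A := A)).image (c * ·)).continuousOn _) hA.1).symm
  rw [hcA.rpow_eq_cfc, hA.rpow_eq_cfc, h1, ← cfc_smul _ _ A (continuousOn_spectrum _ _)]
  exact cfc_congr fun x hx => Real.mul_rpow hc (hA.spectrum_nonneg hx)

lemma trace_re_mul_nonneg {A B : Matrix m m ℂ} (hA : A.PosSemidef) (hB : B.PosSemidef) :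
    0 ≤ (A * B).trace.re := by
  obtain ⟨C, rfl⟩ := CStarAlgebra.nonneg_iff_eq_star_mul_self.mp hB.nonneg
  rw [← mul_assoc, trace_mul_comm, ← mul_assoc, star_eq_conjTranspose]
  exact (Complex.le_def.mp (hA.mul_mul_conjTranspose_same C).trace_nonneg).1

lemma trace_re_mul_le {A B C : Matrix m m ℂ} (hBC : B ≤ C) (hA : A.PosSemidef) :
    (A * B).trace.re ≤ (A * C).trace.re := by
  have := trace_re_mul_nonneg hA (le_iff.mp hBC)
  rw [mul_sub, trace_sub, Complex.sub_re] at this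
  linarith

lemma exists_pos_forall_le {ι : Type*} [Finite ι] {f : ι → ℝ} (hf : ∀ i, 0 < f i) :
    ∃ c > 0, ∀ i, c ≤ f i := by
  rcases isEmpty_or_nonempty ι with h | h
  · exact ⟨1, one_pos, fun i => h.elim i⟩
  · obtain ⟨i, hi⟩ := Finite.exists_min f
    exact ⟨f i, hf i, hi⟩

lemma smul_one_le_iff {A : Matrix m m ℂ} (hA : A.IsHermitian) {c : ℝ} :
    c • (1 : Matrix m m ℂ) ≤ A ↔ ∀ i, c ≤ hA.eigenvalues i := by
  rw [← Algebra.algebraMap_eq_smul_one, algebraMap_le_iff_le_spectrum (ha := hA),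
    hA.spectrum_real_eq_range_eigenvalues, Set.forall_mem_range]

lemma le_smul_one_iff {A : Matrix m m ℂ} (hA : A.IsHermitian) {c : ℝ} :
    A ≤ c • (1 : Matrix m m ℂ) ↔ ∀ i, hA.eigenvalues i ≤ c := by
  rw [← Algebra.algebraMap_eq_smul_one, le_algebraMap_iff_spectrum_le (ha := hA),
    hA.spectrum_real_eq_range_eigenvalues, Set.forall_mem_range]

lemma PosDef.exists_smul_one_le {A : Matrix m m ℂ} (hA : A.PosDef) :
    ∃ c : ℝ, 0 < c ∧ c • (1 : Matrix m m ℂ) ≤ A := by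
  obtain ⟨c, hc, h⟩ := exists_pos_forall_le hA.eigenvalues_pos
  exact ⟨c, hc, (smul_one_le_iff hA.1).mpr h⟩

lemma IsHermitian.exists_le_smul_one {A : Matrix m m ℂ} (hA : A.IsHermitian) :
    ∃ c : ℝ, 0 < c ∧ A ≤ c • (1 : Matrix m m ℂ) := by
  refine ⟨1 + ∑ i, |hA.eigenvalues i|, by positivity, (le_smul_one_iff hA).mpr fun i => ?_⟩
  have := Finset.single_le_sum (fun i _ => abs_nonneg (hA.eigenvalues i)) (Finset.mem_univ i)
  linarith [le_abs_self (hA.eigenvalues i)]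

lemma posDef_of_smul_one_le {A : Matrix m m ℂ} {c : ℝ} (hc : 0 < c)
    (h : c • (1 : Matrix m m ℂ) ≤ A) : A.PosDef := by
  have h1 : (c • (1 : Matrix m m ℂ)).PosDef := PosDef.one.smul hc
  simpa using h1.add_posSemidef (le_iff.mp h)

lemma PosDef.of_le {A B : Matrix m m ℂ} (hA : A.PosDef) (h : A ≤ B) : B.PosDef := by
  simpa using hA.add_posSemidef (le_iff.mp h)

lemma PosSemidef.trace_re_pos {A : Matrix m m ℂ} (hA : A.PosSemidef) (h : A ≠ 0) :
    0 < A.trace.re := by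
  have h1 := Complex.le_def.mp hA.trace_nonneg
  refine lt_of_le_of_ne h1.1 fun h2 => h (hA.trace_eq_zero_iff.mp ?_)
  exact Complex.ext h2.symm h1.2.symm

lemma trace_re_mul_pos {A B : Matrix m m ℂ} (hA : A.PosDef) (hB : B.PosSemidef) (h : B ≠ 0) :
    0 < (B * A).trace.re := by
  obtain ⟨c, hc, hcA⟩ := hA.exists_smul_one_le
  have := trace_re_mul_le hcA hB
  rw [mul_smul_comm, _root_.mul_one, trace_smul, Complex.smul_re, smul_eq_mul] at this
  have := mul_pos hc (hB.trace_re_pos h)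
  linarith

/-- Used to pass from definiteness of the sum of the A_j to that of the sum of their powers. Only
finitely many eigenvalues matter, and 0 is harmless as 0^r = 0. -/
lemma PosSemidef.exists_smul_le_rpow {A : Matrix m m ℂ} (hA : A.PosSemidef) {r : ℝ}
    (hr : r ≠ 0) : ∃ c : ℝ, 0 < c ∧ c • A ≤ A ^ r := by
  obtain ⟨c, hc, h⟩ := exists_pos_forall_le (f := fun i => if hA.1.eigenvalues i = 0 then 1 else
    hA.1.eigenvalues i ^ (r - 1)) (fun i => by
      have := hA.eigenvalues_nonneg i
      split_ifs with h
      · exact one_pos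
      · exact Real.rpow_pos_of_pos (lt_of_le_of_ne this (Ne.symm h)) _)
  refine ⟨c, hc, ?_⟩
  have h1 : c • A = cfc (fun x : ℝ => c * x) A := (cfc_const_mul_id c A hA.1).symm
  rw [h1, hA.rpow_eq_cfc]
  refine cfc_mono (fun x hx => ?_) (continuousOn_spectrum _ _) (continuousOn_spectrum _ _)
  rw [hA.1.spectrum_real_eq_range_eigenvalues] at hx
  obtain ⟨i, rfl⟩ := hx
  have hi := h i
  split_ifs at hi with h0
  · simp [h0, Real.zero_rpow hr]
  · have hpos := lt_of_le_of_ne (hA.eigenvalues_nonneg i) (Ne.symm h0)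
    calc c * _ ≤ hA.1.eigenvalues i ^ (r - 1) * hA.1.eigenvalues i := by gcongr
      _ = _ := by rw [← Real.rpow_add_one hpos.ne', sub_add_cancel]

lemma continuousOn_rpow_posDef (r : ℝ) :
    ContinuousOn (fun A : Matrix m m ℂ => A ^ r) {A | A.PosDef} := by
  open scoped Matrix.Norms.L2Operator in
  simp_rw [← Matrix.isStrictlyPositive_iff_posDef]
  exact CFC.continuousOn_rpow r

open scoped Matrix.Norms.L2Operator in
lemma continuousOn_rpow_posSemidef {r : ℝ} (hr : 0 < r) :
    ContinuousOn (fun A : Matrix m m ℂ => A ^ r) {A | A.PosSemidef} := by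
  have h := CFC.continuousOn_nnrpow (A := Matrix m m ℂ) ⟨r, hr.le⟩
  simp_rw [← nonneg_iff_posSemidef]
  refine h.congr fun A hA => ?_
  exact (CFC.nnrpow_eq_rpow (x := ⟨r, hr.le⟩) hr).symm

open scoped Matrix.Norms.L2Operator in
lemma isClosed_setOf_posSemidef : IsClosed {A : Matrix m m ℂ | A.PosSemidef} := by
  simp_rw [← nonneg_iff_posSemidef]
  exact CStarAlgebra.isClosed_nonneg

open scoped Matrix.Norms.L2Operator in
-- Inversion reverses the order, and the power -r in [0, 1] preserves it by Löwner–Heinz.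
lemma rpow_antitone {A B : Matrix m m ℂ} (hA : A.PosDef) (hAB : A ≤ B) {r : ℝ}
    (hr : r ∈ Set.Icc (-1) 0) : B ^ r ≤ A ^ r := by
  have h := CStarAlgebra.rpow_neg_one_le_rpow_neg_one hAB hA.isStrictlyPositive
  have h2 := CFC.rpow_le_rpow (p := -r) ⟨by linarith [hr.2], by linarith [hr.1]⟩ h
  rwa [(hA.of_le hAB).posSemidef.rpow_rpow, hA.posSemidef.rpow_rpow, neg_mul_neg, one_mul] at h2

lemma PosSemidef.le_trace_smul_one {A : Matrix m m ℂ} (hA : A.PosSemidef) :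
    A ≤ A.trace.re • (1 : Matrix m m ℂ) := by
  rw [le_smul_one_iff hA.1]
  intro i
  rw [hA.1.trace_eq_sum_eigenvalues, Complex.re_sum]
  exact Finset.single_le_sum (f := fun i => hA.1.eigenvalues i)
    (fun i _ => hA.eigenvalues_nonneg i) (Finset.mem_univ i)

open scoped Matrix.Norms.L2Operator in
-- With c = 0 this is the set of all states; c > 0 keeps away from singular matrices. Boundedness
-- follows from A ≤ Tr A • 1.
lemma isCompact_setOf_le_trace_eq_one {c : ℝ} (hc : 0 ≤ c) :
    IsCompact {A : Matrix m m ℂ | c • (1 : Matrix m m ℂ) ≤ A ∧ A.trace = 1} := by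
  have : ProperSpace (Matrix m m ℂ) := FiniteDimensional.proper ℂ _
  refine Metric.isCompact_of_isClosed_isBounded ?_ ?_
  · refine IsClosed.inter ?_ ?_
    · exact isClosed_setOf_posSemidef.preimage (f := fun A : Matrix m m ℂ => A - c • 1)
        (by fun_prop)
    · exact isClosed_eq (by fun_prop) continuous_const
  · refine (Metric.isBounded_closedBall (x := (0 : Matrix m m ℂ)) (r := 1)).subset ?_
    rintro A ⟨hA, htr⟩
    have h0 : 0 ≤ A := (smul_nonneg hc (nonneg_iff_posSemidef.mpr (PosSemidef.one (n := m) (R := ℂ)))).trans hA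
    have h1 := (nonneg_iff_posSemidef.mp h0).le_trace_smul_one
    rw [htr] at h1
    rw [mem_closedBall_zero_iff]
    exact (CStarAlgebra.norm_le_one_iff_of_nonneg A h0).mpr (by simpa using h1)

end Matrix

/-! ### Scalar inequalities -/

namespace Real

/-- The tangent-line inequality for the convex function `x ↦ x ^ p`, `p > 1` or `p < 0`. -/
lemma mul_rpow_sub_one_mul_le {p x y : ℝ} (hx : 0 ≤ x) (hy : 0 ≤ y)
    (hp : 1 < p ∨ p < 0 ∧ 0 < x ∧ 0 < y) :
    p * (x ^ (p - 1) * y) ≤ y ^ p + (p - 1) * x ^ p := by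
  rcases hp with hp | ⟨hp, hx, hy⟩
  · have hp0 : 0 < p := by linarith
    have h := Real.geom_mean_le_arith_mean2_weighted (w₁ := 1 / p) (w₂ := (p - 1) / p)
      (p₁ := y ^ p) (p₂ := x ^ p) (by positivity) (div_nonneg (by linarith) hp0.le)
      (by positivity) (by positivity) (by field_simp; ring)
    rw [← Real.rpow_mul hy, ← Real.rpow_mul hx, mul_one_div_cancel hp0.ne', Real.rpow_one,
      mul_div_cancel₀ _ hp0.ne'] at h
    calc p * (x ^ (p - 1) * y) = p * (y * x ^ (p - 1)) := by ring
      _ ≤ p * (1 / p * y ^ p + (p - 1) / p * x ^ p) := by gcongr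
      _ = _ := by field_simp
  · have hp1 : 0 < 1 - p := by linarith
    -- The weights are chosen so that y cancels in the geometric mean, leaving x^p.
    have h := Real.geom_mean_le_arith_mean2_weighted (w₁ := 1 / (1 - p)) (w₂ := -p / (1 - p))
      (p₁ := y ^ p) (p₂ := x ^ (p - 1) * y) (by positivity) (div_nonneg (by linarith) hp1.le)
      (by positivity) (by positivity) (by field_simp; ring)
    have h1 : (y ^ p) ^ (1 / (1 - p)) * (x ^ (p - 1) * y) ^ (-p / (1 - p)) = x ^ p := by
      rw [Real.mul_rpow (by positivity) hy.le, ← Real.rpow_mul hy.le, ← Real.rpow_mul hx.le,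
        mul_left_comm, ← Real.rpow_add hy]
      have e1 : p * (1 / (1 - p)) + -p / (1 - p) = 0 := by ring
      have e2 : (p - 1) * (-p / (1 - p)) = p := by field_simp; ring
      rw [e1, e2, Real.rpow_zero, mul_one]
    rw [h1] at h
    have h2 : (1 - p) * x ^ p ≤ y ^ p + -p * (x ^ (p - 1) * y) := by
      calc (1 - p) * x ^ p ≤ (1 - p) * (1 / (1 - p) * y ^ p + -p / (1 - p) * (x ^ (p - 1) * y)) := by
            gcongr
        _ = _ := by field_simp
    linarith

lemma rpow_mul_rpow_one_sub_lt {a x y : ℝ} (ha : a ∈ Set.Ioo (0 : ℝ) 1) (hx : 0 < x) (hy : 0 < y)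
    (hxy : x ≠ y) : x ^ a * y ^ (1 - a) < a * x + (1 - a) * y := by
  have ha1 : 0 < 1 - a := by linarith [ha.2]
  have h := strictConcaveOn_log_Ioi.2 hx hy hxy ha.1 ha1 (by ring)
  simp only [smul_eq_mul] at h
  have hpos : 0 < a * x + (1 - a) * y := by have := ha.1; positivity
  rw [← Real.log_lt_log_iff (by positivity) hpos,
    Real.log_mul (by positivity) (by positivity), Real.log_rpow hx, Real.log_rpow hy]
  exact h

end Real

/-! ### Trace inequalities of Klein and Young -/

namespace Matrix

set_option linter.unusedSectionVars false

variable {m : Type*} [Fintype m] [DecidableEq m]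

/-- Klein's inequality for the trace of powers. -/
lemma trace_rpow_tangent_le {X Y : Matrix m m ℂ} (hX : X.PosSemidef) (hY : Y.PosSemidef) {p : ℝ}
    (hp : 1 < p ∨ p < 0 ∧ X.PosDef ∧ Y.PosDef) :
    p * (X ^ (p - 1) * Y).trace.re ≤ (Y ^ p).trace.re + (p - 1) * (X ^ p).trace.re := by
  obtain ⟨W, hW, h⟩ := exists_trace_cfc_mul_cfc hX.1 hY.1
  have h1 := h (fun x => x ^ (p - 1)) id
  have h2 := h (fun _ => 1) (fun x => x ^ p)
  have h3 := h (fun x => x ^ p) (fun _ => 1)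
  rw [← hX.rpow_eq_cfc, cfc_id ℝ Y hY.isHermitian.isSelfAdjoint] at h1
  rw [← hY.rpow_eq_cfc, cfc_const_one ℝ X hX.isHermitian.isSelfAdjoint, one_mul] at h2
  rw [← hX.rpow_eq_cfc, cfc_const_one ℝ Y hY.isHermitian.isSelfAdjoint, mul_one] at h3
  rw [h1, h2, h3, Finset.mul_sum, Finset.mul_sum, ← Finset.sum_add_distrib]
  refine Finset.sum_le_sum fun i _ => ?_
  rw [Finset.mul_sum, Finset.mul_sum, ← Finset.sum_add_distrib]
  refine Finset.sum_le_sum fun k _ => ?_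
  have := Real.mul_rpow_sub_one_mul_le (p := p) (hX.eigenvalues_nonneg i) (hY.eigenvalues_nonneg k)
    (hp.imp_right fun h => ⟨h.1, h.2.1.eigenvalues_pos i, h.2.2.eigenvalues_pos k⟩)
  have := mul_le_mul_of_nonneg_right this (hW i k)
  simp only [id]
  linarith

/-- In terms of the weights, Tr (A - B)^2 = ∑ (a_i - b_k)^2 W_ik, which vanishes. -/
lemma eq_of_forall_weight {A B : Matrix m m ℂ} (hA : A.IsHermitian) (hB : B.IsHermitian)
    {W : m → m → ℝ} (h : ∀ f g : ℝ → ℝ, (cfc f A * cfc g B).trace.re =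
        ∑ i, ∑ k, f (hA.eigenvalues i) * g (hB.eigenvalues k) * W i k)
    (h0 : ∀ i k, W i k ≠ 0 → hA.eigenvalues i = hB.eigenvalues k) : A = B := by
  have h1 := h id id
  have h2 := h (fun x => x * x) (fun _ => 1)
  have h3 := h (fun _ => 1) (fun x => x * x)
  rw [cfc_id ℝ A hA.isSelfAdjoint, cfc_id ℝ B hB.isSelfAdjoint] at h1
  rw [cfc_mul _ _ A (continuousOn_spectrum _ _) (continuousOn_spectrum _ _), cfc_id' ℝ A hA.isSelfAdjoint,
    cfc_const_one ℝ B hB.isSelfAdjoint, mul_one] at h2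
  rw [cfc_mul _ _ B (continuousOn_spectrum _ _) (continuousOn_spectrum _ _), cfc_id' ℝ B hB.isSelfAdjoint,
    cfc_const_one ℝ A hA.isSelfAdjoint, one_mul] at h3
  have key : (A * A).trace.re + (B * B).trace.re - 2 * (A * B).trace.re = 0 := by
    rw [h1, h2, h3, Finset.mul_sum, ← Finset.sum_add_distrib, ← Finset.sum_sub_distrib]
    refine Finset.sum_eq_zero fun i _ => ?_
    rw [Finset.mul_sum, ← Finset.sum_add_distrib, ← Finset.sum_sub_distrib]
    refine Finset.sum_eq_zero fun k _ => ?_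
    by_cases hw : W i k = 0
    · simp [hw]
    · rw [h0 i k hw]; simp only [id]; ring
  have hAB : (A - B).IsHermitian := hA.sub hB
  have hps := posSemidef_conjTranspose_mul_self (A - B)
  by_contra hne
  have hne' : (A - B)ᴴ * (A - B) ≠ 0 := by
    rw [Ne, conjTranspose_mul_self_eq_zero, sub_eq_zero]; exact hne
  have hpos := hps.trace_re_pos hne'
  rw [hAB.eq, sub_mul, mul_sub, mul_sub, trace_sub, trace_sub, trace_sub, trace_mul_comm B A] at hpos
  simp only [Complex.sub_re] at hpos
  linarith

/-- The trace form of Young's inequality, with its equality case. -/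
lemma trace_rpow_mul_rpow_le {A B : Matrix m m ℂ} (hA : A.PosDef) (hB : B.PosDef) {a : ℝ}
    (ha : a ∈ Set.Ioo (0 : ℝ) 1) :
    (A ^ a * B ^ (1 - a)).trace.re ≤ a * A.trace.re + (1 - a) * B.trace.re ∧
    ((A ^ a * B ^ (1 - a)).trace.re = a * A.trace.re + (1 - a) * B.trace.re → A = B) := by
  obtain ⟨W, hW, h⟩ := exists_trace_cfc_mul_cfc hA.1 hB.1
  have h1 := h (fun x => x ^ a) (fun x => x ^ (1 - a))
  have h2 := h id (fun _ => 1)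
  have h3 := h (fun _ => 1) id
  rw [← hA.posSemidef.rpow_eq_cfc, ← hB.posSemidef.rpow_eq_cfc] at h1
  rw [cfc_const_one ℝ B hB.isHermitian.isSelfAdjoint, mul_one, cfc_id ℝ A hA.isHermitian.isSelfAdjoint] at h2
  rw [cfc_const_one ℝ A hA.isHermitian.isSelfAdjoint, one_mul, cfc_id ℝ B hB.isHermitian.isSelfAdjoint] at h3
  have hdiff : a * A.trace.re + (1 - a) * B.trace.re - (A ^ a * B ^ (1 - a)).trace.re =
      ∑ i, ∑ k, (a * hA.1.eigenvalues i + (1 - a) * hB.1.eigenvalues k -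
        hA.1.eigenvalues i ^ a * hB.1.eigenvalues k ^ (1 - a)) * W i k := by
    rw [h1, h2, h3, Finset.mul_sum, Finset.mul_sum, ← Finset.sum_add_distrib,
      ← Finset.sum_sub_distrib]
    refine Finset.sum_congr rfl fun i _ => ?_
    rw [Finset.mul_sum, Finset.mul_sum, ← Finset.sum_add_distrib, ← Finset.sum_sub_distrib]
    refine Finset.sum_congr rfl fun k _ => ?_
    simp only [id]; ring
  have hterm : ∀ i k, 0 ≤ (a * hA.1.eigenvalues i + (1 - a) * hB.1.eigenvalues k -
        hA.1.eigenvalues i ^ a * hB.1.eigenvalues k ^ (1 - a)) * W i k := by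
    intro i k
    refine mul_nonneg (sub_nonneg.mpr ?_) (hW i k)
    exact Real.geom_mean_le_arith_mean2_weighted ha.1.le (by linarith [ha.2])
      (hA.eigenvalues_pos i).le (hB.eigenvalues_pos k).le (by ring)
  constructor
  · have := Finset.sum_nonneg fun i (_ : i ∈ Finset.univ) =>
      Finset.sum_nonneg fun k (_ : k ∈ Finset.univ) => hterm i k
    linarith
  · intro heq
    refine eq_of_forall_weight hA.1 hB.1 h fun i k hik => ?_
    rw [heq, sub_self] at hdiff
    have hz := (Finset.sum_eq_zero_iff_of_nonneg fun i _ =>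
      Finset.sum_nonneg fun k (_ : k ∈ Finset.univ) => hterm i k).mp hdiff.symm i (Finset.mem_univ i)
    have hz := (Finset.sum_eq_zero_iff_of_nonneg fun k _ => hterm i k).mp hz k (Finset.mem_univ k)
    by_contra hne
    have := Real.rpow_mul_rpow_one_sub_lt ha (hA.eigenvalues_pos i) (hB.eigenvalues_pos k) hne
    rcases mul_eq_zero.mp hz with h | h
    · linarith
    · exact hik h

/-- It suffices to test against the rank-one matrices v v*. -/
lemma IsHermitian.posSemidef_of_trace_re_mul_nonneg {X : Matrix m m ℂ} (hX : X.IsHermitian)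
    (h : ∀ V : Matrix m m ℂ, V.PosSemidef → 0 ≤ (X * V).trace.re) : X.PosSemidef := by
  refine PosSemidef.of_dotProduct_mulVec_nonneg hX fun v => ?_
  have := h _ (posSemidef_vecMulVec_self_star v)
  rw [mul_vecMulVec, trace_vecMulVec, dotProduct_comm] at this
  exact Complex.le_def.mpr ⟨this, (hX.im_star_dotProduct_mulVec_self v).symm⟩

/-- Comparison with a scalar matrix is a statement about the spectrum, so no operator monotonicity
is needed and r may be below -1. -/
lemma smul_one_le_rpow {A : Matrix m m ℂ} (hA : A.PosDef) {c r : ℝ} (hr : r ≤ 0)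
    (h : A ≤ c • (1 : Matrix m m ℂ)) : c ^ r • (1 : Matrix m m ℂ) ≤ A ^ r := by
  rw [hA.posSemidef.rpow_eq_cfc, ← Algebra.algebraMap_eq_smul_one]
  refine algebraMap_le_cfc _ _ A (fun x hx => ?_) (continuousOn_spectrum _ _) hA.1
  rw [← Algebra.algebraMap_eq_smul_one, le_algebraMap_iff_spectrum_le (ha := hA.1)] at h
  exact Real.rpow_le_rpow_of_nonpos (hA.spectrum_pos hx) (h x hx) hr

end Matrix

/-! ### The weighted average and uniqueness of fixed points -/

namespace PetzAugustin

set_option linter.unusedSectionVars false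

variable {m ι : Type*} [Fintype m] [DecidableEq m] [Fintype ι]

/-- The weighted average `∑ⱼ wⱼ Bⱼ / Tr[Bⱼ U]`. -/
noncomputable def average (w : ι → ℝ) (B : ι → Matrix m m ℂ) (U : Matrix m m ℂ) : Matrix m m ℂ :=
  ∑ j, (w j / (B j * U).trace.re) • B j

variable {w : ι → ℝ} {B : ι → Matrix m m ℂ}

lemma trace_average_mul (U V : Matrix m m ℂ) :
    (average w B U * V).trace.re = ∑ j, w j * ((B j * V).trace.re / (B j * U).trace.re) := by
  rw [average, Finset.sum_mul, Matrix.trace_sum, Complex.re_sum]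
  refine Finset.sum_congr rfl fun j _ => ?_
  rw [smul_mul_assoc, Matrix.trace_smul, Complex.smul_re, smul_eq_mul]
  ring

lemma trace_average_mul_self (hw_sum : ∑ j, w j = 1) {U : Matrix m m ℂ}
    (hU : ∀ j, 0 < (B j * U).trace.re) : (average w B U * U).trace.re = 1 := by
  rw [trace_average_mul, ← hw_sum]
  refine Finset.sum_congr rfl fun j _ => ?_
  rw [div_self (hU j).ne', mul_one]

lemma posDef_of_sum_smul {c : ι → ℝ} (hc : ∀ j, 0 < c j) (hB : ∀ j, (B j).PosSemidef)
    (hsum : (∑ j, B j).PosDef) : (∑ j, c j • B j).PosDef := by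
  obtain ⟨e, he, h⟩ := Matrix.exists_pos_forall_le hc
  refine (hsum.smul he : (e • ∑ j, B j).PosDef).of_le ?_
  rw [Finset.smul_sum]
  exact Finset.sum_le_sum fun j _ => smul_le_smul_of_nonneg_right (h j) (hB j).nonneg

lemma average_posDef (hw : ∀ j, 0 < w j) (hB : ∀ j, (B j).PosSemidef)
    (hsum : (∑ j, B j).PosDef) {U : Matrix m m ℂ} (hU : ∀ j, 0 < (B j * U).trace.re) :
    (average w B U).PosDef :=
  posDef_of_sum_smul (fun j => div_pos (hw j) (hU j)) hB hsum

/-- The average is order-reversing and homogeneous of degree -1. -/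
lemma average_le_smul_average (hw : ∀ j, 0 < w j) (hB : ∀ j, (B j).PosSemidef)
    {U V : Matrix m m ℂ} (hU : ∀ j, 0 < (B j * U).trace.re) {c : ℝ} (hc : 0 < c)
    (h : U ≤ c • V) : average w B V ≤ c • average w B U := by
  rw [average, average, Finset.smul_sum]
  refine Finset.sum_le_sum fun j _ => ?_
  rw [smul_smul]
  refine smul_le_smul_of_nonneg_right ?_ (hB j).nonneg
  have h1 := Matrix.trace_re_mul_le h (hB j)
  rw [mul_smul_comm, Matrix.trace_smul, Complex.smul_re, smul_eq_mul] at h1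
  have h2 : 0 < (B j * V).trace.re := pos_of_mul_pos_right ((hU j).trans_le h1) hc.le
  rw [mul_div_assoc', div_le_div_iff₀ h2 (hU j)]
  have := mul_le_mul_of_nonneg_left h1 (hw j).le
  linarith

/-- For exponents in `(-1, 0)` the fixed-point operator is a contraction in Thompson's metric, so
that it has at most one fixed point. -/
lemma eq_of_average_rpow_eq (hw : ∀ j, 0 < w j) (hB : ∀ j, (B j).PosSemidef)
    (hB0 : ∀ j, B j ≠ 0) (hsum : (∑ j, B j).PosDef) {r : ℝ} (hr : r ∈ Set.Ioo (-1) 0)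
    {U V : Matrix m m ℂ} (hU : U.PosDef) (hV : V.PosDef)
    (hfU : average w B U ^ r = U) (hfV : average w B V ^ r = V) : U = V := by
  have hUpos := fun j => Matrix.trace_re_mul_pos hU (hB j) (hB0 j)
  have hVpos := fun j => Matrix.trace_re_mul_pos hV (hB j) (hB0 j)
  have contract : ∀ {X Y : Matrix m m ℂ}, X.PosDef → Y.PosDef → average w B X ^ r = X →
      average w B Y ^ r = Y → ∀ c : ℝ, 0 < c → X ≤ c • Y → X ≤ c ^ (-r) • Y := by
    intro X Y hX hY hfX hfY c hc hXY
    have hXpos := fun j => Matrix.trace_re_mul_pos hX (hB j) (hB0 j)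
    have hYpos := fun j => Matrix.trace_re_mul_pos hY (hB j) (hB0 j)
    have h1 := average_le_smul_average hw hB hXpos hc hXY
    have h2 := Matrix.rpow_antitone (average_posDef hw hB hsum hYpos) h1 ⟨hr.1.le, hr.2.le⟩
    rw [(average_posDef hw hB hsum hXpos).posSemidef.smul_rpow hc.le, hfX, hfY] at h2
    have h3 := smul_le_smul_of_nonneg_left h2 (Real.rpow_nonneg hc.le (-r))
    rwa [smul_smul, ← Real.rpow_add hc, neg_add_cancel, Real.rpow_zero, one_smul] at h3
  have key : ∀ {X Y : Matrix m m ℂ}, X.PosDef → Y.PosDef → average w B X ^ r = X →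
      average w B Y ^ r = Y → X ≤ Y := by
    intro X Y hX hY hfX hfY
    obtain ⟨a, ha, h1⟩ := hX.1.exists_le_smul_one
    obtain ⟨b, hb, h2⟩ := hY.exists_smul_one_le
    have h0 : X ≤ (a / b) • Y := by
      have := smul_le_smul_of_nonneg_left h2 (div_nonneg ha.le hb.le)
      rw [smul_smul, div_mul_cancel₀ _ hb.ne'] at this
      exact h1.trans this
    have hab : 0 < a / b := div_pos ha hb
    -- Each application of the contraction raises the constant to the power -r < 1, so the constants
    -- tend to 1.
    have hk : ∀ k : ℕ, X ≤ ((a / b) ^ ((-r) ^ k)) • Y := by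
      intro k
      induction k with
      | zero => simpa using h0
      | succ k ih =>
        have := contract hX hY hfX hfY _ (Real.rpow_pos_of_pos hab _) ih
        rwa [← Real.rpow_mul hab.le, ← pow_succ] at this
    have hlim : Filter.Tendsto (fun k : ℕ => ((a / b) ^ ((-r) ^ k)) • Y - X) Filter.atTop
        (nhds (Y - X)) := by
      have h1 : Filter.Tendsto (fun k : ℕ => (-r) ^ k) Filter.atTop (nhds 0) :=
        tendsto_pow_atTop_nhds_zero_of_lt_one (by linarith [hr.2]) (by linarith [hr.1])
      have h2 := (tendsto_const_nhds (x := a / b)).rpow h1 (Or.inl hab.ne')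
      rw [Real.rpow_zero] at h2
      have h3 := (h2.smul_const Y).sub_const X
      rwa [one_smul] at h3
    exact Matrix.le_iff.mpr (Matrix.isClosed_setOf_posSemidef.mem_of_tendsto hlim
      (Filter.Eventually.of_forall fun k => Matrix.le_iff.mp (hk k)))
  exact le_antisymm (key hU hV hfU hfV) (key hV hU hfV hfU)

/-- Uniqueness of fixed points for exponents `(1 - a) / a` with `a ∈ (0, 1)`. -/
lemma eq_of_average_rpow_eq' (hw : ∀ j, 0 < w j) (hw_sum : ∑ j, w j = 1)
    (hB : ∀ j, (B j).PosSemidef) (hB0 : ∀ j, B j ≠ 0) (hsum : (∑ j, B j).PosDef) {a : ℝ}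
    (ha : a ∈ Set.Ioo (0 : ℝ) 1) {U V : Matrix m m ℂ} (hU : U.PosDef) (hV : V.PosDef)
    (hfU : average w B U ^ ((1 - a) / a) = U) (hfV : average w B V ^ ((1 - a) / a) = V) :
    U = V := by
  have ha0 : a ≠ 0 := ha.1.ne'
  have ha1 : 1 - a ≠ 0 := by linarith [ha.2]
  -- For a fixed point X, the matrix X^(1/(1-a)) is the corresponding state; its powers a and 1 - a
  -- are the average at X and X itself, and their product has trace 1.
  have hpow : ∀ {X : Matrix m m ℂ}, X.PosDef → average w B X ^ ((1 - a) / a) = X →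
      (X ^ (1 / (1 - a))) ^ a = average w B X ∧ (X ^ (1 / (1 - a))) ^ (1 - a) = X ∧
      (X ^ (1 / (1 - a))).trace.re = 1 := by
    intro X hX hf
    have hXpos := fun j => Matrix.trace_re_mul_pos hX (hB j) (hB0 j)
    have hS := average_posDef hw hB hsum hXpos
    have h1 : (X ^ (1 / (1 - a))) ^ a = average w B X := by
      conv_lhs => rw [← hf]
      rw [hS.posSemidef.rpow_rpow, hS.posSemidef.rpow_rpow]
      have : (1 - a) / a * (1 / (1 - a)) * a = 1 := by field_simp
      rw [this, CFC.rpow_one _ hS.posSemidef.nonneg]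
    have h2 : (X ^ (1 / (1 - a))) ^ (1 - a) = X := by
      rw [hX.posSemidef.rpow_rpow, one_div_mul_cancel ha1, CFC.rpow_one _ hX.posSemidef.nonneg]
    refine ⟨h1, h2, ?_⟩
    have h3 := (hX.rpow (1 / (1 - a))).posSemidef.rpow_mul_rpow (r := a) (s := 1 - a) (by norm_num)
    rw [add_sub_cancel, CFC.rpow_one _ (hX.rpow (1 / (1 - a))).posSemidef.nonneg, h1, h2] at h3
    rw [← h3, trace_average_mul_self hw_sum hXpos]
  obtain ⟨hU1, hU2, hU3⟩ := hpow hU hfU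
  obtain ⟨hV1, hV2, hV3⟩ := hpow hV hfV
  have hlog : ∀ {X Y : Matrix m m ℂ}, X.PosDef → Y.PosDef →
      ∑ j, w j * (Real.log (B j * Y).trace.re - Real.log (B j * X).trace.re) ≤
        (average w B X * Y).trace.re - 1 := by
    intro X Y hX hY
    rw [trace_average_mul, ← hw_sum, ← Finset.sum_sub_distrib]
    refine Finset.sum_le_sum fun j _ => ?_
    have hx := Matrix.trace_re_mul_pos hX (hB j) (hB0 j)
    have hy := Matrix.trace_re_mul_pos hY (hB j) (hB0 j)
    rw [← Real.log_div hy.ne' hx.ne']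
    have := mul_le_mul_of_nonneg_left (Real.log_le_sub_one_of_pos (div_pos hy hx)) (hw j).le
    linarith
  have h1 := hlog hU hV
  have h2 := hlog hV hU
  have h3 : ∑ j, w j * (Real.log (B j * U).trace.re - Real.log (B j * V).trace.re) =
      - ∑ j, w j * (Real.log (B j * V).trace.re - Real.log (B j * U).trace.re) := by
    rw [← Finset.sum_neg_distrib]
    exact Finset.sum_congr rfl fun j _ => by ring
  have hy1 := Matrix.trace_rpow_mul_rpow_le (hU.rpow (1 / (1 - a))) (hV.rpow (1 / (1 - a))) ha
  have hy2 := Matrix.trace_rpow_mul_rpow_le (hV.rpow (1 / (1 - a))) (hU.rpow (1 / (1 - a))) ha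
  rw [hU1, hU3, hV2, hV3] at hy1
  rw [hV1, hV3, hU2, hU3] at hy2
  -- The two logarithmic sums are negatives of each other, and both are bounded above by Young
  -- deficits that are at most 0. Hence equality holds in Young's inequality.
  have hQ := hy1.2 (by linarith [hy1.1, hy2.1])
  rw [← hU2, hQ, hV2]

/-! ### The first-order condition -/

/-- First-order condition: if `U` minimizes `log Tr X ^ p - p ∑ⱼ wⱼ log Tr[Bⱼ X]` among the
matrices `X ≥ U`, and `Tr U ^ p = 1`, then `U ^ (p - 1)` is the weighted average at `U`. -/
lemma posDef_and_average_eq_of_isMin (hw : ∀ j, 0 < w j) (hw_sum : ∑ j, w j = 1)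
    (hB : ∀ j, (B j).PosSemidef) (hsum : (∑ j, B j).PosDef) {p : ℝ} {U : Matrix m m ℂ}
    (hU : U.PosSemidef) (hp : 1 < p ∨ p < 0 ∧ U.PosDef) (hpos : ∀ j, 0 < (B j * U).trace.re)
    (htr : (U ^ p).trace.re = 1)
    (hmin : ∀ X, U ≤ X → -p * ∑ j, w j * Real.log (B j * U).trace.re ≤
      Real.log (X ^ p).trace.re - p * ∑ j, w j * Real.log (B j * X).trace.re) :
    U.PosDef ∧ average w B U = U ^ (p - 1) := by
  have hp0 : p ≠ 0 := by rcases hp with h | h <;> linarith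
  have hderiv : ∀ V : Matrix m m ℂ, V.PosSemidef →
      p * (average w B U * V).trace.re ≤ p * (U ^ (p - 1) * V).trace.re := by
    intro V hV
    have hX : ∀ ε : ℝ, 0 ≤ ε → U ≤ U + ε • V := fun ε hε =>
      le_add_of_nonneg_right (smul_nonneg hε hV.nonneg)
    have hXps : ∀ ε : ℝ, 0 ≤ ε → (U + ε • V).PosSemidef := fun ε hε =>
      Matrix.nonneg_iff_posSemidef.mp (hU.nonneg.trans (hX ε hε))
    have htrX : ∀ (ε : ℝ) (C : Matrix m m ℂ),
        (C * (U + ε • V)).trace.re = (C * U).trace.re + ε * (C * V).trace.re := by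
      intro ε C
      rw [mul_add, mul_smul_comm, Matrix.trace_add, Matrix.trace_smul, Complex.add_re,
        Complex.smul_re, smul_eq_mul]
    have hbound : ∀ ε : ℝ, 0 < ε →
        ε⁻¹ • ((∑ j, p * (w j * Real.log ((B j * U).trace.re + (0 + ε) * (B j * V).trace.re))) -
          ∑ j, p * (w j * Real.log ((B j * U).trace.re + 0 * (B j * V).trace.re))) ≤
        p * ((U + ε • V) ^ (p - 1) * V).trace.re := by
      intro ε hε
      have h1 := hmin _ (hX ε hε.le)
      simp only [htrX] at h1
      -- The tangent is taken at the perturbed point and evaluated at U, so that the limit needs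
      -- only continuity of the matrix power, not its derivative.
      have h2 := Matrix.trace_rpow_tangent_le (hXps ε hε.le) hU (p := p)
        (hp.imp_right fun h => ⟨h.1, h.2.of_le (hX ε hε.le), h.2⟩)
      have h3 : ((U + ε • V) ^ (p - 1) * (U + ε • V)).trace.re = ((U + ε • V) ^ p).trace.re := by
        have := (hXps ε hε.le).rpow_mul_rpow (r := p - 1) (s := 1) (by simpa using hp0)
        rw [CFC.rpow_one _ (hXps ε hε.le).nonneg, sub_add_cancel] at this
        rw [this]
      rw [htrX] at h3
      have h4 : Real.log ((U + ε • V) ^ p).trace.re ≤ ((U + ε • V) ^ p).trace.re - 1 := by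
        refine Real.log_le_sub_one_of_pos ?_
        refine (Matrix.rpow_posSemidef _ _).trace_re_pos fun h0 => ?_
        have hU0 : U + ε • V = 0 := by
          have := (hXps ε hε.le).rpow_rpow p (1 / p)
          rw [h0, mul_one_div_cancel hp0, CFC.rpow_one _ (hXps ε hε.le).nonneg] at this
          rw [← this]
          exact CFC.zero_rpow (one_div_ne_zero hp0)
        have hU1 : U = 0 := le_antisymm (hU0 ▸ hX ε hε.le) hU.nonneg
        have : (U ^ p) = 0 := by rw [hU1]; exact CFC.zero_rpow hp0
        rw [this] at htr
        simp at htr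
      rw [smul_eq_mul, inv_mul_le_iff₀ hε]
      simp only [zero_add, zero_mul, add_zero, ← Finset.mul_sum]
      have h5 : p * ((U + ε • V) ^ (p - 1) * U).trace.re =
        p * ((U + ε • V) ^ p).trace.re - p * (ε * ((U + ε • V) ^ (p - 1) * V).trace.re) := by
        rw [← h3]; ring
      linarith
    have hL : Filter.Tendsto (fun ε : ℝ => ε⁻¹ •
        ((∑ j, p * (w j * Real.log ((B j * U).trace.re + (0 + ε) * (B j * V).trace.re))) -
          ∑ j, p * (w j * Real.log ((B j * U).trace.re + 0 * (B j * V).trace.re))))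
        (nhdsWithin 0 (Set.Ioi 0)) (nhds (p * (average w B U * V).trace.re)) := by
      have hd : HasDerivAt (fun ε : ℝ =>
          ∑ j, p * (w j * Real.log ((B j * U).trace.re + ε * (B j * V).trace.re)))
          (∑ j, p * (w j * ((B j * V).trace.re / (B j * U).trace.re))) 0 := by
        refine HasDerivAt.fun_sum fun j _ => ?_
        refine HasDerivAt.const_mul _ (HasDerivAt.const_mul _ ?_)
        have h := (((hasDerivAt_id (0 : ℝ)).mul_const (B j * V).trace.re).const_add
          (B j * U).trace.re).log (by simpa using (hpos j).ne')
        simpa using h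
      rw [trace_average_mul, Finset.mul_sum]
      exact hd.tendsto_slope_zero_right
    have hcont : Filter.Tendsto (fun ε : ℝ => U + ε • V) (nhdsWithin 0 (Set.Ioi 0)) (nhds U) := by
      have : Filter.Tendsto (fun ε : ℝ => U + ε • V) (nhds 0) (nhds (U + (0 : ℝ) • V)) :=
        (by fun_prop : Continuous fun ε : ℝ => U + ε • V).tendsto 0
      rw [zero_smul, add_zero] at this
      exact this.mono_left nhdsWithin_le_nhds
    have hpw : Filter.Tendsto (fun ε : ℝ => (U + ε • V) ^ (p - 1)) (nhdsWithin 0 (Set.Ioi 0))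
        (nhds (U ^ (p - 1))) := by
      rcases hp with h | h
      · refine (Matrix.continuousOn_rpow_posSemidef (sub_pos.mpr h) U hU).tendsto.comp
          (tendsto_nhdsWithin_iff.mpr ⟨hcont, ?_⟩)
        filter_upwards [self_mem_nhdsWithin] with ε hε using hXps ε (le_of_lt hε)
      · refine (Matrix.continuousOn_rpow_posDef (p - 1) U h.2).tendsto.comp
          (tendsto_nhdsWithin_iff.mpr ⟨hcont, ?_⟩)
        filter_upwards [self_mem_nhdsWithin] with ε hε using h.2.of_le (hX ε (le_of_lt hε))
    have hR : Filter.Tendsto (fun ε : ℝ => p * ((U + ε • V) ^ (p - 1) * V).trace.re)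
        (nhdsWithin 0 (Set.Ioi 0)) (nhds (p * (U ^ (p - 1) * V).trace.re)) := by
      have : Continuous fun X : Matrix m m ℂ => p * (X * V).trace.re := by fun_prop
      exact (this.tendsto _).comp hpw
    refine le_of_tendsto_of_tendsto hL hR ?_
    filter_upwards [self_mem_nhdsWithin] with ε hε using hbound ε hε
  have hS := average_posDef hw hB hsum hpos
  have hps : (p • (U ^ (p - 1) - average w B U)).PosSemidef := by
    refine Matrix.IsHermitian.posSemidef_of_trace_re_mul_nonneg ?_ fun V hV => ?_
    · exact ((Matrix.rpow_posSemidef U _).1.sub hS.1).smul (IsSelfAdjoint.all p)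
    · have := hderiv V hV
      rw [smul_mul_assoc, sub_mul, Matrix.trace_smul, Matrix.trace_sub, Complex.smul_re,
        Complex.sub_re, smul_eq_mul]
      linarith
  have hUpd : U.PosDef := by
    rcases hp with h | h
    · have hle : average w B U ≤ U ^ (p - 1) := by
        have h1 := smul_nonneg (inv_nonneg.mpr (by linarith : 0 ≤ p)) hps.nonneg
        rw [smul_smul, inv_mul_cancel₀ hp0, one_smul] at h1
        exact sub_nonneg.mp h1
      have h2 := (hS.of_le hle).rpow (1 / (p - 1))
      rwa [hU.rpow_rpow, mul_one_div_cancel (by linarith), CFC.rpow_one _ hU.nonneg] at h2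
    · exact h.2
  refine ⟨hUpd, ?_⟩
  -- A nonzero positive semi-definite matrix has positive trace against U, but both terms of the
  -- difference have trace 1 against U.
  by_contra hne
  have hne' : p • (U ^ (p - 1) - average w B U) ≠ 0 :=
    smul_ne_zero hp0 (sub_ne_zero.mpr (Ne.symm hne))
  have h1 := Matrix.trace_re_mul_pos hUpd hps hne'
  have h2 := hU.rpow_mul_rpow (r := p - 1) (s := 1) (by simpa using hp0)
  rw [CFC.rpow_one _ hU.nonneg, sub_add_cancel] at h2
  rw [smul_mul_assoc, sub_mul, h2, Matrix.trace_smul, Matrix.trace_sub, Complex.smul_re,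
    Complex.sub_re, smul_eq_mul, htr, trace_average_mul_self hw_sum hpos] at h1
  simp at h1

end PetzAugustin

/-! ### Finiteness of the objective and existence of minimizers -/

namespace PetzAugustin

variable {d n : ℕ} {α : ℝ} {w : Fin n → ℝ} {A : Fin n → Matrix (Fin d) (Fin d) ℂ}
  {Q : Matrix (Fin d) (Fin d) ℂ}

/-- The points at which every divergence in the objective function is finite. -/
def FiniteAt (α : ℝ) (A : Fin n → Matrix (Fin d) (Fin d) ℂ) (Q : Matrix (Fin d) (Fin d) ℂ) :
    Prop :=
  ∀ j, (1 < α → ∀ v : Fin d → ℂ, Q.mulVec v = 0 → (A j).mulVec v = 0) ∧ 0 < petzTrace α (A j) Q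

/-- The value of the objective function where it is finite. -/
noncomputable def realObjective (α : ℝ) (w : Fin n → ℝ) (A : Fin n → Matrix (Fin d) (Fin d) ℂ)
    (Q : Matrix (Fin d) (Fin d) ℂ) : ℝ :=
  ∑ j, w j * (1 / (α - 1) * Real.log (petzTrace α (A j) Q))

lemma objective_eq_coe (h : FiniteAt α A Q) :
    objective α w A Q = (realObjective α w A Q : EReal) := by
  rw [objective, realObjective]
  refine Eq.trans ?_ (map_sum (⟨⟨Real.toEReal, rfl⟩, EReal.coe_add⟩ : ℝ →+ EReal) _ _).symm
  refine Finset.sum_congr rfl fun j _ => ?_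
  rw [petzRenyiDiv, if_pos (h j), ← EReal.coe_mul]
  rfl

lemma objective_eq_top (hw : ∀ j, 0 < w j) (h : ¬ FiniteAt α A Q) : objective α w A Q = ⊤ := by
  rw [FiniteAt, not_forall] at h
  obtain ⟨j, hj⟩ := h
  have hbot : ∀ i, (w i : EReal) * petzRenyiDiv α (A i) Q ≠ ⊥ := by
    intro i
    rw [petzRenyiDiv]
    split_ifs
    · rw [← EReal.coe_mul]
      exact EReal.coe_ne_bot _
    · rw [EReal.coe_mul_top_of_pos (hw i)]
      exact bot_lt_top.ne'
  rw [objective, ← Finset.add_sum_erase _ _ (Finset.mem_univ j)]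
  have h1 : (w j : EReal) * petzRenyiDiv α (A j) Q = ⊤ := by
    rw [petzRenyiDiv, if_neg hj, EReal.coe_mul_top_of_pos (hw j)]
  rw [h1]
  refine EReal.top_add_of_ne_bot ?_
  refine Finset.sum_induction _ (fun x : EReal => x ≠ ⊥) (fun a b ha hb => ?_) EReal.zero_ne_bot
    fun i _ => hbot i
  rw [Ne, EReal.add_eq_bot_iff]
  exact not_or.mpr ⟨ha, hb⟩

lemma isMinimizer_iff (hw : ∀ j, 0 < w j) (hex : ∃ Q ∈ states d, FiniteAt α A Q) :
    IsMinimizer α w A Q ↔ Q ∈ states d ∧ FiniteAt α A Q ∧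
      ∀ Q' ∈ states d, FiniteAt α A Q' → realObjective α w A Q ≤ realObjective α w A Q' := by
  refine and_congr_right fun _ => ?_
  constructor
  · intro hmin
    have hfin : FiniteAt α A Q := by
      obtain ⟨Q₀, h₀, hf₀⟩ := hex
      by_contra hf
      have := isMinOn_iff.mp hmin Q₀ h₀
      rw [objective_eq_top hw hf, objective_eq_coe hf₀] at this
      exact (EReal.coe_lt_top _).not_ge this
    refine ⟨hfin, fun Q' h' hf' => ?_⟩
    have := isMinOn_iff.mp hmin Q' h'
    rwa [objective_eq_coe hfin, objective_eq_coe hf', EReal.coe_le_coe_iff] at this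
  · rintro ⟨hfin, h⟩
    refine isMinOn_iff.mpr fun Q' h' => ?_
    by_cases hf' : FiniteAt α A Q'
    · rw [objective_eq_coe hfin, objective_eq_coe hf', EReal.coe_le_coe_iff]
      exact h Q' h' hf'
    · rw [objective_eq_top hw hf']
      exact le_top

lemma ne_zero_of_mem_states (hQ : Q ∈ states d) : Q ≠ 0 := by
  rintro rfl
  simpa using hQ.2

lemma rpow_ne_zero_of_mem_states (hα : 0 < α) (hQ : Q ∈ states d) : Q ^ α ≠ 0 := by
  intro h
  have h1 := hQ.1.rpow_rpow α (1 / α)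
  rw [h, mul_one_div_cancel hα.ne', CFC.rpow_one _ hQ.1.nonneg] at h1
  exact ne_zero_of_mem_states hQ (h1.symm.trans (CFC.zero_rpow (one_div_ne_zero hα.ne')))

lemma sum_rpow_posDef (hα : 0 < α) (hA : ∀ j, A j ∈ states d) (hsum : (∑ j, A j).PosDef) :
    (∑ j, A j ^ α).PosDef := by
  choose c hc hcA using fun j => (hA j).1.exists_smul_le_rpow hα.ne'
  exact (posDef_of_sum_smul hc (fun j => (hA j).1) hsum).of_le
    (Finset.sum_le_sum fun j _ => hcA j)

lemma petzTrace_pos_of_posDef (hα : 0 < α) {A₀ : Matrix (Fin d) (Fin d) ℂ} (hA : A₀ ∈ states d)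
    (hQ : Q.PosDef) : 0 < petzTrace α A₀ Q :=
  Matrix.trace_re_mul_pos (hQ.rpow _) (Matrix.rpow_posSemidef _ _)
    (rpow_ne_zero_of_mem_states hα hA)

lemma finiteAt_of_posDef (hα : 0 < α) (hA : ∀ j, A j ∈ states d) (hQ : Q.PosDef) :
    FiniteAt α A Q := by
  refine fun j => ⟨fun _ v hv => ?_, petzTrace_pos_of_posDef hα (hA j) hQ⟩
  have : v = 0 := by
    by_contra h
    have := hQ.dotProduct_mulVec_pos h
    rw [hv, dotProduct_zero] at this
    exact this.false
  rw [this, Matrix.mulVec_zero]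

/-- A vector in the kernel of Q is killed by every A_j, hence by their definite sum. -/
lemma posDef_of_finiteAt (hα : 1 < α) (hsum : (∑ j, A j).PosDef) (hQ : Q.PosSemidef)
    (h : FiniteAt α A Q) : Q.PosDef := by
  refine Matrix.PosDef.of_dotProduct_mulVec_pos hQ.1 fun v hv => ?_
  refine lt_of_le_of_ne (hQ.dotProduct_mulVec_nonneg v) fun h0 => ?_
  have h1 := (hQ.dotProduct_mulVec_zero_iff v).mp h0.symm
  have h2 := hsum.dotProduct_mulVec_pos hv
  rw [Matrix.sum_mulVec, Finset.sum_eq_zero fun j _ => (h j).1 hα v h1, dotProduct_zero] at h2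
  exact h2.false

lemma exists_posDef_mem_states (hd : d ≠ 0) :
    ∃ Q : Matrix (Fin d) (Fin d) ℂ, Q.PosDef ∧ Q ∈ states d := by
  have hd' : (0 : ℝ) < (d : ℝ)⁻¹ := inv_pos.mpr (Nat.cast_pos.mpr (Nat.pos_of_ne_zero hd))
  have h : ((d : ℝ)⁻¹ • (1 : Matrix (Fin d) (Fin d) ℂ)).PosDef := Matrix.PosDef.one.smul hd'
  refine ⟨_, h, h.posSemidef, ?_⟩
  rw [Matrix.trace_smul, Matrix.trace_one, Fintype.card_fin, Complex.real_smul]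
  push_cast
  exact inv_mul_cancel₀ (Nat.cast_ne_zero.mpr hd)

lemma isCompact_states (d : ℕ) : IsCompact (states d) := by
  convert Matrix.isCompact_setOf_le_trace_eq_one (m := Fin d) le_rfl using 3
  simp [states, Matrix.nonneg_iff_posSemidef]

/-- The product of the traces to the powers w_j is continuous on all states, unlike its logarithm.
As 1/(α-1) < 0, it is to be maximized, and a maximizer has no zero factor. -/
lemma exists_isMinimizer_of_lt_one (hα : α ∈ Set.Ioo (0 : ℝ) 1) (hw : ∀ j, 0 < w j)
    (hA : ∀ j, A j ∈ states d) (hd : d ≠ 0) : ∃ Q, IsMinimizer α w A Q := by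
  obtain ⟨Q₀, hQ₀, hs₀⟩ := exists_posDef_mem_states hd
  have hf₀ := finiteAt_of_posDef hα.1 hA hQ₀
  have hcont : ContinuousOn (fun Q => ∏ j, petzTrace α (A j) Q ^ w j) (states d) := by
    refine continuousOn_finsetProd _ fun j _ => ?_
    refine ContinuousOn.rpow_const ?_ fun _ _ => Or.inr (hw j).le
    have h1 : ContinuousOn (fun Q : Matrix (Fin d) (Fin d) ℂ => Q ^ (1 - α)) (states d) :=
      (Matrix.continuousOn_rpow_posSemidef (by linarith [hα.2])).mono fun Q hQ => hQ.1
    have h2 : Continuous fun X : Matrix (Fin d) (Fin d) ℂ => (A j ^ α * X).trace.re := by fun_prop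
    exact h2.comp_continuousOn h1
  obtain ⟨Q, hQ, hmax⟩ := (isCompact_states d).exists_isMaxOn ⟨Q₀, hs₀⟩ hcont
  have hnn : ∀ j, 0 ≤ petzTrace α (A j) Q := fun j =>
    Matrix.trace_re_mul_nonneg (Matrix.rpow_posSemidef _ _) (Matrix.rpow_posSemidef _ _)
  have hlog : ∀ {X}, FiniteAt α A X → realObjective α w A X =
      1 / (α - 1) * Real.log (∏ j, petzTrace α (A j) X ^ w j) := by
    intro X hX
    rw [realObjective, Real.log_prod fun j _ => (Real.rpow_pos_of_pos (hX j).2 _).ne',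
      Finset.mul_sum]
    refine Finset.sum_congr rfl fun j _ => ?_
    rw [Real.log_rpow (hX j).2]
    ring
  have hprod : ∀ {X}, FiniteAt α A X → 0 < ∏ j, petzTrace α (A j) X ^ w j := fun hX =>
    Finset.prod_pos fun j _ => Real.rpow_pos_of_pos (hX j).2 _
  have hfin : FiniteAt α A Q := by
    refine fun j => ⟨fun h => absurd h (not_lt.mpr hα.2.le), (hnn j).lt_of_ne' fun h0 => ?_⟩
    have h1 := (hprod hf₀).trans_le (isMaxOn_iff.mp hmax Q₀ hs₀)
    rw [Finset.prod_eq_zero (Finset.mem_univ j) (by rw [h0, Real.zero_rpow (hw j).ne'])] at h1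
    exact h1.false
  refine ⟨Q, (isMinimizer_iff hw ⟨Q₀, hs₀, hf₀⟩).mpr ⟨hQ, hfin, fun Q' hQ' hf' => ?_⟩⟩
  rw [hlog hfin, hlog hf']
  refine mul_le_mul_of_nonpos_left ?_ (one_div_nonpos.mpr (by linarith [hα.2]))
  exact Real.log_le_log (hprod hf') (isMaxOn_iff.mp hmax Q' hQ')

/-- For `α > 1`, the states with bounded objective are bounded away from the singular ones. -/
lemma exists_smul_one_le_of_realObjective_le (hα : 1 < α) (hw : ∀ j, 0 < w j)
    (hA : ∀ j, A j ∈ states d) (hsum : (∑ j, A j).PosDef) (M : ℝ) :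
    ∃ ε : ℝ, 0 < ε ∧ ∀ Q ∈ states d, Q.PosDef → realObjective α w A Q ≤ M →
      ε • (1 : Matrix (Fin d) (Fin d) ℂ) ≤ Q := by
  have hα0 : 0 < α := by linarith
  have hα1 : 0 < α - 1 := by linarith
  obtain ⟨c, hc, hcB⟩ := (sum_rpow_posDef hα0 hA hsum).exists_smul_one_le
  -- From Q ≤ 1 follows Q^(1-α) ≥ 1, which bounds the other terms of the objective below and so
  -- leaves at most `R j` for the j-th. Then `K` bounds Tr Q^(1-α), the summand 1 making it
  -- positive, and inverting Q^(1-α) ≤ K gives the lower bound on Q.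
  set R : Fin n → ℝ := fun j => (M - ∑ i ∈ Finset.univ.erase j,
    w i * (1 / (α - 1) * Real.log (A i ^ α).trace.re)) with hR
  set K : ℝ := c⁻¹ * ∑ j, Real.exp ((α - 1) * (R j / w j)) + 1 with hK
  have hKpos : 0 < K := by positivity
  refine ⟨K ^ (1 / (1 - α)), Real.rpow_pos_of_pos hKpos _, fun Q hQ hpd hM => ?_⟩
  have hQ1 : Q ≤ (1 : ℝ) • (1 : Matrix (Fin d) (Fin d) ℂ) := by
    have := hQ.1.le_trace_smul_one
    rwa [hQ.2, Complex.one_re] at this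
  have hU1 := Matrix.smul_one_le_rpow hpd (r := 1 - α) (by linarith) hQ1
  rw [Real.one_rpow, one_smul] at hU1
  have ha : ∀ j, 0 < (A j ^ α).trace.re := fun j =>
    (Matrix.rpow_posSemidef _ _).trace_re_pos (rpow_ne_zero_of_mem_states hα0 (hA j))
  have hta : ∀ j, (A j ^ α).trace.re ≤ petzTrace α (A j) Q := by
    intro j
    have := Matrix.trace_re_mul_le hU1 (Matrix.rpow_posSemidef (A j) α)
    rwa [mul_one] at this
  have ht : ∀ j, petzTrace α (A j) Q ≤ Real.exp ((α - 1) * (R j / w j)) := by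
    intro j
    have hpos := (ha j).trans_le (hta j)
    rw [← Real.log_le_iff_le_exp hpos]
    have h1 : ∑ i ∈ Finset.univ.erase j, w i * (1 / (α - 1) * Real.log (A i ^ α).trace.re) ≤
        ∑ i ∈ Finset.univ.erase j, w i * (1 / (α - 1) * Real.log (petzTrace α (A i) Q)) := by
      refine Finset.sum_le_sum fun i _ => ?_
      refine mul_le_mul_of_nonneg_left (mul_le_mul_of_nonneg_left ?_ (by positivity)) (hw i).le
      exact Real.log_le_log (ha i) (hta i)
    rw [realObjective, ← Finset.add_sum_erase _ _ (Finset.mem_univ j)] at hM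
    have h2 : w j * (1 / (α - 1) * Real.log (petzTrace α (A j) Q)) ≤ R j := by
      simp only [hR]
      linarith
    have h3 := (le_div_iff₀' (hw j)).mpr h2
    calc Real.log (petzTrace α (A j) Q)
        = (α - 1) * (1 / (α - 1) * Real.log (petzTrace α (A j) Q)) := by field_simp
      _ ≤ _ := mul_le_mul_of_nonneg_left h3 hα1.le
  have htr : c * (Q ^ (1 - α)).trace.re ≤ ∑ j, petzTrace α (A j) Q := by
    have h1 := Matrix.trace_re_mul_le hcB (Matrix.rpow_posSemidef Q (1 - α))
    rw [mul_smul_comm, mul_one, Matrix.trace_smul, Complex.smul_re, smul_eq_mul,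
      Matrix.trace_mul_comm, Finset.sum_mul, Matrix.trace_sum, Complex.re_sum] at h1
    exact h1
  have hUK : (Q ^ (1 - α)).trace.re ≤ K := by
    have h1 := htr.trans (Finset.sum_le_sum fun j _ => ht j)
    rw [← le_div_iff₀' hc, div_eq_inv_mul] at h1
    linarith
  have hUle : Q ^ (1 - α) ≤ K • (1 : Matrix (Fin d) (Fin d) ℂ) :=
    (Matrix.rpow_posSemidef Q (1 - α)).le_trace_smul_one.trans
      (smul_le_smul_of_nonneg_right hUK (Matrix.nonneg_iff_posSemidef.mpr Matrix.PosSemidef.one))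
  have h := Matrix.smul_one_le_rpow (hpd.rpow (1 - α)) (r := 1 / (1 - α))
    (one_div_nonpos.mpr (by linarith)) hUle
  rwa [hQ.1.rpow_rpow, mul_one_div_cancel (by linarith), CFC.rpow_one _ hQ.1.nonneg] at h

lemma exists_isMinimizer_of_one_lt (hα : 1 < α) (hw : ∀ j, 0 < w j)
    (hA : ∀ j, A j ∈ states d) (hsum : (∑ j, A j).PosDef) (hd : d ≠ 0) :
    ∃ Q, IsMinimizer α w A Q := by
  have hα0 : 0 < α := by linarith
  obtain ⟨Q₀, hQ₀, hs₀⟩ := exists_posDef_mem_states hd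
  obtain ⟨ε, hε, h⟩ := exists_smul_one_le_of_realObjective_le hα hw hA hsum
    (realObjective α w A Q₀)
  set K := {Q : Matrix (Fin d) (Fin d) ℂ | ε • (1 : Matrix (Fin d) (Fin d) ℂ) ≤ Q ∧ Q.trace = 1}
    with hK
  have hKpd : ∀ Q ∈ K, Q.PosDef := fun Q hQ => Matrix.posDef_of_smul_one_le hε hQ.1
  have hcont : ContinuousOn (realObjective α w A) K := by
    refine continuousOn_finsetSum _ fun j _ => ?_
    refine continuousOn_const.mul (continuousOn_const.mul (ContinuousOn.log ?_ fun Q hQ =>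
      (petzTrace_pos_of_posDef hα0 (hA j) (hKpd Q hQ)).ne'))
    have h1 : ContinuousOn (fun Q : Matrix (Fin d) (Fin d) ℂ => Q ^ (1 - α)) K :=
      (Matrix.continuousOn_rpow_posDef _).mono hKpd
    have h2 : Continuous fun X : Matrix (Fin d) (Fin d) ℂ => (A j ^ α * X).trace.re := by fun_prop
    exact h2.comp_continuousOn h1
  have hK₀ : Q₀ ∈ K := ⟨h Q₀ hs₀ hQ₀ le_rfl, hs₀.2⟩
  obtain ⟨Q, hQ, hmin⟩ := (Matrix.isCompact_setOf_le_trace_eq_one hε.le).exists_isMinOn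
    ⟨Q₀, hK₀⟩ hcont
  refine ⟨Q, (isMinimizer_iff hw ⟨Q₀, hs₀, finiteAt_of_posDef hα0 hA hQ₀⟩).mpr
    ⟨⟨(hKpd Q hQ).posSemidef, hQ.2⟩, finiteAt_of_posDef hα0 hA (hKpd Q hQ), fun Q' hQ' hf' => ?_⟩⟩
  have hpd' := posDef_of_finiteAt hα hsum hQ'.1 hf'
  rcases le_total (realObjective α w A Q') (realObjective α w A Q₀) with hle | hle
  · exact isMinOn_iff.mp hmin Q' ⟨h Q' hQ' hpd' hle, hQ'.2⟩
  · exact (isMinOn_iff.mp hmin Q₀ hK₀).trans hle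

/-! ### From minimizers to fixed points -/

/-- The objective function at the normalization of `X ^ (1 / (1 - α))`. -/
lemma realObjective_normalized (hα : α ≠ 1) (hw_sum : ∑ j, w j = 1)
    {X : Matrix (Fin d) (Fin d) ℂ} (hX : X.PosSemidef)
    (hpos : ∀ j, 0 < (A j ^ α * X).trace.re) (htr : 0 < (X ^ (1 / (1 - α))).trace.re) :
    (∀ j, 0 < petzTrace α (A j) ((X ^ (1 / (1 - α))).trace.re⁻¹ • X ^ (1 / (1 - α)))) ∧
    realObjective α w A ((X ^ (1 / (1 - α))).trace.re⁻¹ • X ^ (1 / (1 - α))) =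
      Real.log (X ^ (1 / (1 - α))).trace.re -
        1 / (1 - α) * ∑ j, w j * Real.log (A j ^ α * X).trace.re := by
  have hα1 : 1 - α ≠ 0 := sub_ne_zero.mpr hα.symm
  have hα2 : α - 1 ≠ 0 := sub_ne_zero.mpr hα
  set c := (X ^ (1 / (1 - α))).trace.re with hc
  have ht : ∀ j, petzTrace α (A j) (c⁻¹ • X ^ (1 / (1 - α))) =
      c⁻¹ ^ (1 - α) * (A j ^ α * X).trace.re := by
    intro j
    rw [petzTrace, (Matrix.rpow_posSemidef X _).smul_rpow (inv_nonneg.mpr htr.le), hX.rpow_rpow,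
      one_div_mul_cancel hα1, CFC.rpow_one _ hX.nonneg, mul_smul_comm, Matrix.trace_smul,
      Complex.smul_re, smul_eq_mul]
  have hcp : 0 < c⁻¹ ^ (1 - α) := Real.rpow_pos_of_pos (inv_pos.mpr htr) _
  refine ⟨fun j => by rw [ht]; exact mul_pos hcp (hpos j), ?_⟩
  rw [realObjective]
  have h1 : ∀ j, w j * (1 / (α - 1) * Real.log (petzTrace α (A j) (c⁻¹ • X ^ (1 / (1 - α))))) =
      w j * Real.log c - 1 / (1 - α) * (w j * Real.log (A j ^ α * X).trace.re) := by
    intro j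
    rw [ht, Real.log_mul hcp.ne' (hpos j).ne', Real.log_rpow (inv_pos.mpr htr), Real.log_inv]
    have : 1 / (α - 1) = - (1 / (1 - α)) := by rw [← neg_sub, one_div_neg_eq_neg_one_div]
    rw [this]
    field_simp
    ring
  rw [Finset.sum_congr rfl fun j _ => h1 j, Finset.sum_sub_distrib, ← Finset.sum_mul, hw_sum,
    one_mul, ← Finset.mul_sum]

lemma posDef_and_isFixedPt_of_isMinimizer (hα : α ∈ Set.Ioo (0 : ℝ) 1 ∪ Set.Ioi (1 : ℝ))
    (hw : ∀ j, 0 < w j) (hw_sum : ∑ j, w j = 1) (hA : ∀ j, A j ∈ states d)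
    (hsum : (∑ j, A j).PosDef) (hd : d ≠ 0) (hQ : IsMinimizer α w A Q) :
    Q.PosDef ∧ Function.IsFixedPt (fixOp α w A) (Q ^ (1 - α)) := by
  have hα0 : 0 < α := by
    rcases hα with h | h
    · exact h.1
    · exact one_pos.trans h
  have hαne : α ≠ 1 := by
    rcases hα with h | h
    · exact h.2.ne
    · exact (ne_of_gt h)
  have hα1 : 1 - α ≠ 0 := sub_ne_zero.mpr hαne.symm
  obtain ⟨Q₀, hQ₀, hs₀⟩ := exists_posDef_mem_states hd
  obtain ⟨hs, hfin, hmin⟩ :=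
    (isMinimizer_iff hw ⟨Q₀, hs₀, finiteAt_of_posDef hα0 hA hQ₀⟩).mp hQ
  have hpow : (Q ^ (1 - α)) ^ (1 / (1 - α)) = Q := by
    rw [hs.1.rpow_rpow, mul_one_div_cancel hα1, CFC.rpow_one _ hs.1.nonneg]
  have hUps := Matrix.rpow_posSemidef Q (1 - α)
  have hB := fun j => Matrix.rpow_posSemidef (A j) α
  have htr : ((Q ^ (1 - α)) ^ (1 / (1 - α))).trace.re = 1 := by rw [hpow, hs.2, Complex.one_re]
  have hpos : ∀ j, 0 < (A j ^ α * Q ^ (1 - α)).trace.re := fun j => (hfin j).2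
  -- For α < 1 definiteness is not yet known; it is part of the conclusion of the first-order
  -- condition.
  have hp : 1 < 1 / (1 - α) ∨ 1 / (1 - α) < 0 ∧ (Q ^ (1 - α)).PosDef := by
    rcases hα with h | h
    · exact Or.inl (one_lt_one_div (by linarith [h.2]) (by linarith [h.1]))
    · have h1 : 1 < α := h
      exact Or.inr ⟨one_div_neg.mpr (by linarith), (posDef_of_finiteAt h1 hsum hs.1 hfin).rpow _⟩
  -- The competitor for a given X is the state obtained by normalizing X^(1/(1-α)).
  obtain ⟨hUpd, heq⟩ := posDef_and_average_eq_of_isMin hw hw_sum hB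
    (sum_rpow_posDef hα0 hA hsum) hUps hp hpos htr (fun X hX => by
      have hXps : X.PosSemidef := Matrix.nonneg_iff_posSemidef.mp (hUps.nonneg.trans hX)
      have hXpos : ∀ j, 0 < (A j ^ α * X).trace.re := fun j =>
        (hpos j).trans_le (Matrix.trace_re_mul_le hX (hB j))
      have hXtr : 0 < (X ^ (1 / (1 - α))).trace.re := by
        refine (Matrix.rpow_posSemidef _ _).trace_re_pos fun h0 => ?_
        have h1 := hXps.rpow_rpow (1 / (1 - α)) (1 - α)
        rw [h0, one_div_mul_cancel hα1, CFC.rpow_one _ hXps.nonneg] at h1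
        have h2 : X = 0 := h1.symm.trans (CFC.zero_rpow hα1)
        have h3 : Q ^ (1 - α) = 0 := le_antisymm (h2 ▸ hX) hUps.nonneg
        rw [h3] at hpow
        exact ne_zero_of_mem_states hs (hpow.symm.trans (CFC.zero_rpow (one_div_ne_zero hα1)))
      obtain ⟨hX1, hX2⟩ := realObjective_normalized (A := A) hαne hw_sum hXps hXpos hXtr
      obtain ⟨-, hU2⟩ := realObjective_normalized (A := A) hαne hw_sum hUps hpos
        (by rw [htr]; exact one_pos)
      rw [htr, inv_one, one_smul, hpow, Real.log_one] at hU2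
      have hcps : ((X ^ (1 / (1 - α))).trace.re⁻¹ • X ^ (1 / (1 - α))).PosSemidef :=
        Matrix.nonneg_iff_posSemidef.mp (smul_nonneg (inv_nonneg.mpr hXtr.le)
          (Matrix.rpow_posSemidef _ _).nonneg)
      have hstate : (X ^ (1 / (1 - α))).trace.re⁻¹ • X ^ (1 / (1 - α)) ∈ states d := by
        refine ⟨hcps, ?_⟩
        have him := (Complex.le_def.mp (Matrix.rpow_posSemidef X (1 / (1 - α))).trace_nonneg).2
        rw [Matrix.trace_smul]
        refine Complex.ext ?_ ?_
        · rw [Complex.smul_re, smul_eq_mul, inv_mul_cancel₀ hXtr.ne', Complex.one_re]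
        · rw [Complex.smul_im, ← him, Complex.zero_im, smul_zero, Complex.one_im]
      have hfinX : FiniteAt α A ((X ^ (1 / (1 - α))).trace.re⁻¹ • X ^ (1 / (1 - α))) := by
        rcases hα with h | h
        · exact fun j => ⟨fun h' => absurd h' (not_lt.mpr h.2.le), hX1 j⟩
        · have hUpd := (posDef_of_finiteAt h hsum hs.1 hfin).rpow (1 - α)
          exact finiteAt_of_posDef hα0 hA
            (((hUpd.of_le hX).rpow (1 / (1 - α))).smul (inv_pos.mpr hXtr))
      have := hmin _ hstate hfinX
      rw [hU2, hX2] at this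
      linarith)
  have hQpd : Q.PosDef := hpow ▸ hUpd.rpow (1 / (1 - α))
  refine ⟨hQpd, ?_⟩
  change average w (fun j => A j ^ α) (Q ^ (1 - α)) ^ ((1 - α) / α) = Q ^ (1 - α)
  rw [heq, hs.1.rpow_rpow, hs.1.rpow_rpow]
  congr 1
  field_simp
  ring

lemma mapsTo_fixOp (hα : 0 < α) (hw : ∀ j, 0 < w j) (hA : ∀ j, A j ∈ states d)
    (hsum : (∑ j, A j).PosDef) : Set.MapsTo (fixOp α w A) (posCone d) (posCone d) := fun _ hU =>
  (average_posDef hw (fun j => Matrix.rpow_posSemidef (A j) α) (sum_rpow_posDef hα hA hsum)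
    fun j => Matrix.trace_re_mul_pos hU (Matrix.rpow_posSemidef (A j) α)
      (rpow_ne_zero_of_mem_states hα (hA j))).rpow _

lemma isFixedPt_unique (hα : α ∈ Set.Ioo (0 : ℝ) 1 ∪ Set.Ioi (1 : ℝ))
    (hw : ∀ j, 0 < w j) (hw_sum : ∑ j, w j = 1) (hA : ∀ j, A j ∈ states d)
    (hsum : (∑ j, A j).PosDef) {U V : Matrix (Fin d) (Fin d) ℂ} (hU : U.PosDef) (hV : V.PosDef)
    (hfU : Function.IsFixedPt (fixOp α w A) U) (hfV : Function.IsFixedPt (fixOp α w A) V) :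
    U = V := by
  have hα0 : 0 < α := by
    rcases hα with h | h
    · exact h.1
    · exact one_pos.trans h
  have hB := fun j => Matrix.rpow_posSemidef (A j) α
  have hB0 := fun j => rpow_ne_zero_of_mem_states hα0 (hA j)
  have hBsum := sum_rpow_posDef hα0 hA hsum
  rcases hα with h | h
  · exact eq_of_average_rpow_eq' hw hw_sum hB hB0 hBsum h hU hV hfU hfV
  · have h1 : 1 < α := h
    refine eq_of_average_rpow_eq hw hB hB0 hBsum (r := (1 - α) / α) ⟨?_, ?_⟩ hU hV hfU hfV
    · rw [lt_div_iff₀ hα0]; linarith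
    · exact div_neg_of_neg_of_pos (by linarith) hα0

lemma posDef_sum_of_rank (hA : ∀ j, A j ∈ states d) (h : (∑ j, A j).rank = d) :
    (∑ j, A j).PosDef := by
  have hps := Matrix.posSemidef_sum Finset.univ fun j _ => (hA j).1
  refine hps.1.posDef_iff_eigenvalues_pos.mpr fun i => (hps.eigenvalues_nonneg i).lt_of_ne' ?_
  by_contra h0
  rw [hps.1.rank_eq_card_non_zero_eigs] at h
  have := Fintype.card_subtype_lt (p := fun i => hps.1.eigenvalues i ≠ 0) (not_not.mpr h0)
  rw [h, Fintype.card_fin] at this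
  exact this.false

end PetzAugustin

theorem mainTheorem2 {d n : ℕ} (α : ℝ) (hα : α ∈ Set.Ioo (0 : ℝ) 1 ∪ Set.Ioi (1 : ℝ))
    (w : Fin n → ℝ) (hw_pos : ∀ j, 0 < w j) (hw_sum : ∑ j, w j = 1)
    (A : Fin n → Matrix (Fin d) (Fin d) ℂ) (hA : ∀ j, A j ∈ PetzAugustin.states d)
    (hA_rank : (∑ j, A j).rank = d) :
    Set.MapsTo (PetzAugustin.fixOp α w A) (PetzAugustin.posCone d) (PetzAugustin.posCone d) ∧
    ∃ Q : Matrix (Fin d) (Fin d) ℂ,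
      PetzAugustin.IsMinimizer α w A Q ∧
      (∀ Q', PetzAugustin.IsMinimizer α w A Q' → Q' = Q) ∧
      Q ∈ PetzAugustin.posCone d ∧
      Q ^ (1 - α) ∈ PetzAugustin.posCone d ∧
      Function.IsFixedPt (PetzAugustin.fixOp α w A) (Q ^ (1 - α)) ∧
      ∀ U ∈ PetzAugustin.posCone d,
        Function.IsFixedPt (PetzAugustin.fixOp α w A) U → U = Q ^ (1 - α) := by
  have hsum := PetzAugustin.posDef_sum_of_rank hA hA_rank
  -- There are no states for d = 0, so n would be 0 and the weights could not sum to 1.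
  have hd : d ≠ 0 := by
    rintro rfl
    have : IsEmpty (Fin n) := ⟨fun j =>
      PetzAugustin.ne_zero_of_mem_states (hA j) (Subsingleton.elim _ _)⟩
    simp at hw_sum
  have hα0 : 0 < α := by
    rcases hα with h | h
    · exact h.1
    · exact one_pos.trans h
  have hα1 : 1 - α ≠ 0 := by
    rcases hα with h | h
    · exact (sub_pos.mpr h.2).ne'
    · exact (sub_neg.mpr h).ne
  refine ⟨PetzAugustin.mapsTo_fixOp hα0 hw_pos hA hsum, ?_⟩
  obtain ⟨Q, hQ⟩ : ∃ Q, PetzAugustin.IsMinimizer α w A Q := by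
    rcases hα with h | h
    · exact PetzAugustin.exists_isMinimizer_of_lt_one h hw_pos hA hd
    · exact PetzAugustin.exists_isMinimizer_of_one_lt h hw_pos hA hsum hd
  have key := fun {Q'} (h : PetzAugustin.IsMinimizer α w A Q') =>
    PetzAugustin.posDef_and_isFixedPt_of_isMinimizer hα hw_pos hw_sum hA hsum hd h
  obtain ⟨hpd, hfix⟩ := key hQ
  refine ⟨Q, hQ, fun Q' hQ' => ?_, hpd, hpd.rpow _, hfix, fun U hU hfU =>
    PetzAugustin.isFixedPt_unique hα hw_pos hw_sum hA hsum hU (hpd.rpow _) hfU hfix⟩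
  obtain ⟨hpd', hfix'⟩ := key hQ'
  have h := PetzAugustin.isFixedPt_unique hα hw_pos hw_sum hA hsum (hpd'.rpow _) (hpd.rpow _)
    hfix' hfix
  have h2 : (Q' ^ (1 - α)) ^ (1 / (1 - α)) = (Q ^ (1 - α)) ^ (1 / (1 - α)) := by rw [h]
  rwa [hpd'.posSemidef.rpow_rpow, hpd.posSemidef.rpow_rpow, mul_one_div_cancel hα1,
    CFC.rpow_one _ hpd'.posSemidef.nonneg, CFC.rpow_one _ hpd.posSemidef.nonneg] at h2
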